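/- Label the vertices of the butterfly network (the $2\times 3$ grid) by $1,\dots,6$, with edges $12, 34, 56, 13, 35, 24, 46$. For a vertex $v$ of a simple graph $G=(V,E)$ let $LC_v(G)=(V,E\,\Delta\,K_{N_v})$ be the local complementation at $v$, where $K_{N_v}$ is the edge set of the complete graph on the neighbourhood of $v$, and let $LC_{i,j}=LC_iLC_jLC_i$. Let $|G\rangle=\prod_{\{i,j\}\in E}CZ_{i,j}|+\rangle^{\otimes V}$ be the graph state of $G$. Then: 1. $LC_{1,2}$ maps the butterfly network to the 6-vertex ring $1-2-3-5-6-4-1$, and the graph states of these two graphs are locally equivalent: a tensor product of single-qubit Clifford unitaries maps the graph state of the butterfly network to that of the ring. 2. No protocol consisting of single-qubit Clifford operations, single-qubit Pauli measurements and classical communication (so that operations may depend on earlier measurement outcomes) transforms the graph state of this ring, or the graph state of the butterfly network, into a state that consists of a Bell pair on the qubits $1,3$, a Bell pair on the qubits $2,5$, and some state of the qubits $4,6$; not even for a single sequence of measurement outcomes of positive probability. -/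

import Mathlib

/-! ### Graphs and local complementation -/

/-- The complete graph on the vertex set `s`, viewed as a graph on all of `V`. -/
def completeOn {V : Type*} (s : Set V) : SimpleGraph V where
  Adj x y := x ≠ y ∧ x ∈ s ∧ y ∈ s
  symm := ⟨fun _ _ h => ⟨h.1.symm, h.2.2, h.2.1⟩⟩
  loopless := ⟨fun _ h => h.1 rfl⟩

/-- Local complementation `LC_v`: the edge set `E` is replaced by `E ∆ K_{N_v}`
(`∆` is the symmetric difference of graphs on `V`). -/
def localComplement {V : Type*} (v : V) (G : SimpleGraph V) : SimpleGraph V :=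
  symmDiff G (completeOn (G.neighborSet v))

/-- `LC_{i,j} = LC_i LC_j LC_i`. -/
def localComplementPair {V : Type*} (i j : V) (G : SimpleGraph V) : SimpleGraph V :=
  localComplement i (localComplement j (localComplement i G))

/-- The butterfly network, i.e. the `2 × 3` grid
```
  1 - 3 - 5
  |   |   |
  2 - 4 - 6
```
The six vertices are the elements of `Fin 6`, written `1, …, 6`; here `6` is another name for
the element `0` of `Fin 6`, so these are six different vertices. -/
def butterfly : SimpleGraph (Fin 6) :=
  SimpleGraph.fromEdgeSet {s(1, 2), s(3, 4), s(5, 6), s(1, 3), s(3, 5), s(2, 4), s(4, 6)}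

/-- The hexagon `1 - 2 - 3 - 5 - 6 - 4 - 1`. -/
def hexagon : SimpleGraph (Fin 6) :=
  SimpleGraph.fromEdgeSet {s(1, 2), s(2, 3), s(3, 5), s(5, 6), s(6, 4), s(4, 1)}

/-! ### Qubits, graph states -/

/-- (Not necessarily normalised) state vectors of `V`-indexed qubits, that is, elements of
`(ℂ²)^{⊗V}`, given by their coordinates in the computational basis. -/
abbrev QState (V : Type*) : Type _ := (V → Fin 2) → ℂ

/-- `|+⟩^{⊗V}`. -/
noncomputable def plusState (V : Type*) [Fintype V] : QState V :=
  fun _ => ((1 / Real.sqrt 2 : ℝ) : ℂ) ^ Fintype.card V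

open Classical in
/-- The controlled-`Z` gate on the two ends of `e`: a diagonal operator, given here by
its diagonal, with entry `-1` at the basis vectors that are `1` at both ends of `e`. -/
noncomputable def czDiagonal {V : Type*} (e : Sym2 V) : (V → Fin 2) → ℂ :=
  fun x => if ∀ v ∈ e, x v = 1 then -1 else 1

open Classical in
/-- The graph state `|G⟩ = ∏_{e ∈ E} CZ_e |+⟩^{⊗V}`. -/
noncomputable def graphState {V : Type*} [Fintype V] (G : SimpleGraph V) : QState V :=
  fun x => (∏ e ∈ G.edgeFinset, czDiagonal e x) * plusState V x

/-! ### Local Clifford operations and local Pauli measurements -/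

/-- The three Pauli observables. -/
inductive Pauli : Type
  | X
  | Y
  | Z

/-- The Pauli matrices. -/
noncomputable def Pauli.mat : Pauli → Matrix (Fin 2) (Fin 2) ℂ
  | .X => !![0, 1; 1, 0]
  | .Y => !![0, -Complex.I; Complex.I, 0]
  | .Z => !![1, 0; 0, -1]

/-- Single-qubit Clifford operations: unitaries that map each Pauli matrix, by conjugation, to a
Pauli matrix up to sign. -/
def IsClifford (U : Matrix (Fin 2) (Fin 2) ℂ) : Prop :=
  U ∈ Matrix.unitaryGroup (Fin 2) ℂ ∧
    ∀ P : Pauli, ∃ Q : Pauli, U * P.mat * star U = Q.mat ∨ U * P.mat * star U = -Q.mat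

/-- The one-qubit operator `A` acting on the qubit `v`. -/
noncomputable def applyAt {V : Type*} [DecidableEq V] (v : V) (A : Matrix (Fin 2) (Fin 2) ℂ)
    (ψ : QState V) : QState V :=
  fun x => ∑ b : Fin 2, A (x v) b * ψ (Function.update x v b)

/-- The product operator `⨂_v A_v`. -/
noncomputable def applyLocal {V : Type*} [Fintype V] [DecidableEq V]
    (A : V → Matrix (Fin 2) (Fin 2) ℂ) (ψ : QState V) : QState V :=
  fun x => ∑ y : V → Fin 2, (∏ v, A v (x v) (y v)) * ψ y

/-- Two states are locally (Clifford) equivalent if a product of single-qubit Clifford operations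
maps one to the other. -/
def LocallyEquivalent {V : Type*} [Fintype V] [DecidableEq V] (ψ φ : QState V) : Prop :=
  ∃ U : V → Matrix (Fin 2) (Fin 2) ℂ, (∀ v, IsClifford (U v)) ∧ applyLocal U ψ = φ

/-- The projection onto the eigenspace of `P` for the eigenvalue `+1` (outcome `false`) or
`-1` (outcome `true`). -/
noncomputable def pauliProjection (P : Pauli) (outcome : Bool) : Matrix (Fin 2) (Fin 2) ℂ :=
  (1 / 2 : ℂ) • (1 + (if outcome then (-1 : ℂ) else 1) • P.mat)

/-- Adaptive protocols made of local Clifford operations, local Pauli measurements and classical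
communication: after a measurement, everything that is done later, on any qubit, may depend on
the outcome. -/
inductive Protocol (V : Type*) : Type _
  | done : Protocol V
  | clifford (v : V) (U : Matrix (Fin 2) (Fin 2) ℂ) (hU : IsClifford U) (next : Protocol V) :
      Protocol V
  | measure (v : V) (P : Pauli) (next : Bool → Protocol V) : Protocol V

/-- The (unnormalised) states in which a protocol that starts in `ψ` may end: one for each
sequence of measurement outcomes that has positive probability. After a measurement with a given
outcome the state is the corresponding projection of the previous one; the outcome has
probability zero if and only if this projection vanishes. -/
def Protocol.finalStates {V : Type*} [DecidableEq V] : Protocol V → QState V → Set (QState V)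
  | .done, ψ => {ψ}
  | .clifford v U _ next, ψ => next.finalStates (applyAt v U ψ)
  | .measure v P next, ψ =>
      {φ | ∃ outcome : Bool, applyAt v (pauliProjection P outcome) ψ ≠ 0 ∧
        φ ∈ (next outcome).finalStates (applyAt v (pauliProjection P outcome) ψ)}

/-- The Bell state `(|00⟩ + |11⟩) / √2` in coordinates. -/
noncomputable def bell (i j : Fin 2) : ℂ :=
  if i = j then ((1 / Real.sqrt 2 : ℝ) : ℂ) else 0

/-- The state `ψ` consists of a Bell pair on the qubits `a, b`, a Bell pair on the qubits `c, d`
and an arbitrary (not necessarily normalised) state of the other qubits. -/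
def IsTwoBellPairs {V : Type*} (a b c d : V) (ψ : QState V) : Prop :=
  ∃ rest : QState {v : V // v ≠ a ∧ v ≠ b ∧ v ≠ c ∧ v ≠ d},
    ∀ x : V → Fin 2, ψ x = bell (x a) (x b) * bell (x c) (x d) * rest (fun v => x v)

/-- Some protocol turns `ψ`, with positive probability, into a state with Bell pairs between
`a, b` and between `c, d`. -/
def BellPairsExtractable {V : Type*} [DecidableEq V] (a b c d : V) (ψ : QState V) : Prop :=
  ∃ p : Protocol V, ∃ φ ∈ p.finalStates ψ, IsTwoBellPairs a b c d φ

/-! ### The two graphs -/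

/-! The graph identity is a finite check. Pivoting on the edge `12` acts on the graph state as
Hadamards at `1` and `2`, since these have no common neighbour (`applyAt_hadamard_butterfly`). For
the impossibility, fix the measurement outcomes: the whole branch becomes one product operator `⨂
A_v` with nonzero output (`Protocol.exists_applyLocal_of_mem_finalStates`). A Bell pair has full
Schmidt rank, so `A 1`, `A 2`, `A 3`, `A 5` are invertible (`det_ne_zero_of_applyLocal_eq_bell`).
Undoing them preserves products across `13 | 25 | 46`, so the hexagon state with operators only at
`4` and `6` would be such a product. The edge `23` rules this out
(`not_isTripleProduct_of_hexagon`). The butterfly follows by local equivalence. -/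

theorem localComplement_adj {V : Type*} (v : V) (G : SimpleGraph V) (x y : V) :
    (localComplement v G).Adj x y ↔
      Xor (G.Adj x y) (x ≠ y ∧ G.Adj v x ∧ G.Adj v y) := by
  simp [localComplement, symmDiff, completeOn, Xor]

instance localComplement.decidableRel {V : Type*} [DecidableEq V] (v : V) (G : SimpleGraph V)
    [DecidableRel G.Adj] : DecidableRel (localComplement v G).Adj :=
  fun x y => decidable_of_iff' _ (localComplement_adj v G x y)

theorem butterfly_adj (x y : Fin 6) : butterfly.Adj x y ↔
    s(x, y) ∈ ({s(1, 2), s(3, 4), s(5, 6), s(1, 3), s(3, 5), s(2, 4), s(4, 6)} :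
      Finset (Sym2 (Fin 6))) := by
  simp only [butterfly, SimpleGraph.fromEdgeSet_adj, Set.mem_insert_iff, Set.mem_singleton_iff,
    Finset.mem_insert, Finset.mem_singleton]
  revert x y
  decide

theorem hexagon_adj (x y : Fin 6) : hexagon.Adj x y ↔
    s(x, y) ∈ ({s(1, 2), s(2, 3), s(3, 5), s(5, 6), s(6, 4), s(4, 1)} :
      Finset (Sym2 (Fin 6))) := by
  simp only [hexagon, SimpleGraph.fromEdgeSet_adj, Set.mem_insert_iff, Set.mem_singleton_iff,
    Finset.mem_insert, Finset.mem_singleton]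
  revert x y
  decide

instance butterfly.decidableRel : DecidableRel butterfly.Adj :=
  fun x y => decidable_of_iff' _ (butterfly_adj x y)

instance hexagon.decidableRel : DecidableRel hexagon.Adj :=
  fun x y => decidable_of_iff' _ (hexagon_adj x y)

set_option maxRecDepth 4000 in
theorem localComplementPair_butterfly : localComplementPair 1 2 butterfly = hexagon := by
  ext x y
  unfold localComplementPair
  revert x y
  decide +kernel

/-- The position of each vertex when the hexagon is traversed as `1 - 2 - 3 - 5 - 6 - 4`. -/
def hexagonIsoCycleGraph : hexagon ≃g SimpleGraph.cycleGraph 6 where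
  -- Entry `0` of the vector is the position of vertex `6`, as `6 = 0` in `Fin 6`.
  toFun := ![4, 0, 1, 2, 5, 3]
  invFun := ![1, 2, 3, 5, 6, 4]
  left_inv := by unfold Function.LeftInverse; decide
  right_inv := by unfold Function.RightInverse Function.LeftInverse; decide
  map_rel_iff' := by
    intro x y
    revert x y
    decide +kernel

/-! ### Amplitudes of the two graph states. -/

open Classical in
theorem graphState_eq_prod {V : Type*} [Fintype V] {G : SimpleGraph V} (s : Finset (Sym2 V))
    (h : ∀ a b, G.Adj a b ↔ s(a, b) ∈ s) (x : V → Fin 2) :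
    graphState G x = (∏ e ∈ s, czDiagonal e x) * plusState V x := by
  unfold graphState
  congr 2
  ext e
  induction e with
  | h a b => rw [SimpleGraph.mem_edgeFinset, SimpleGraph.mem_edgeSet, h]

theorem graphState_butterfly (x : Fin 6 → Fin 2) : graphState butterfly x =
    czDiagonal s(1, 2) x * czDiagonal s(3, 4) x * czDiagonal s(5, 6) x * czDiagonal s(1, 3) x *
      czDiagonal s(3, 5) x * czDiagonal s(2, 4) x * czDiagonal s(4, 6) x *
      plusState (Fin 6) x := by
  rw [graphState_eq_prod _ butterfly_adj]
  repeat rw [Finset.prod_insert (by decide)]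
  rw [Finset.prod_singleton]
  ring

theorem graphState_hexagon (x : Fin 6 → Fin 2) : graphState hexagon x =
    czDiagonal s(1, 2) x * czDiagonal s(2, 3) x * czDiagonal s(3, 5) x * czDiagonal s(5, 6) x *
      czDiagonal s(6, 4) x * czDiagonal s(4, 1) x * plusState (Fin 6) x := by
  rw [graphState_eq_prod _ hexagon_adj]
  repeat rw [Finset.prod_insert (by decide)]
  rw [Finset.prod_singleton]
  ring

theorem czDiagonal_mk {V : Type*} (a b : V) (x : V → Fin 2) :
    czDiagonal s(a, b) x = if x a = 1 ∧ x b = 1 then -1 else 1 := by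
  simp [czDiagonal]

theorem graphState_ne_zero {V : Type*} [Fintype V] (G : SimpleGraph V) (x : V → Fin 2) :
    graphState G x ≠ 0 := by
  refine mul_ne_zero (Finset.prod_ne_zero_iff.2 fun e _ => ?_) ?_
  · unfold czDiagonal
    split_ifs <;> simp
  · simp [plusState]

/-! ### Product operators -/

theorem applyAt_zero {V : Type*} [DecidableEq V] (v : V) (M : Matrix (Fin 2) (Fin 2) ℂ) :
    applyAt v M (0 : QState V) = 0 := by
  ext x
  simp [applyAt]

section Operators

variable {V : Type*} [Fintype V] [DecidableEq V]

theorem applyLocal_applyLocal (A B : V → Matrix (Fin 2) (Fin 2) ℂ) (ψ : QState V) :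
    applyLocal A (applyLocal B ψ) = applyLocal (A * B) ψ := by
  ext x
  simp only [applyLocal, Finset.mul_sum]
  rw [Finset.sum_comm]
  refine Finset.sum_congr rfl fun z _ => ?_
  simp only [Pi.mul_apply, Matrix.mul_apply]
  rw [Finset.prod_univ_sum, Fintype.piFinset_univ, Finset.sum_mul]
  refine Finset.sum_congr rfl fun y _ => ?_
  rw [Finset.prod_mul_distrib, mul_assoc]

/-- Identity factors away from `v` kill every basis vector that differs from `x` there, leaving the
two updates of `x` at `v`. -/
theorem applyAt_eq_applyLocal (v : V) (M : Matrix (Fin 2) (Fin 2) ℂ) (ψ : QState V) :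
    applyAt v M ψ = applyLocal (Function.update 1 v M) ψ := by
  ext x
  unfold applyAt applyLocal
  have hinj : Function.Injective fun b : Fin 2 => Function.update x v b :=
    Function.update_injective x v
  rw [← Finset.sum_subset (Finset.subset_univ (Finset.univ.image fun b => Function.update x v b)),
    Finset.sum_image fun a _ b _ h => hinj h]
  · refine Finset.sum_congr rfl fun b _ => ?_
    congr 1
    rw [← Finset.mul_prod_erase _ _ (Finset.mem_univ v), Finset.prod_eq_one]
    · simp
    · intro w hw
      have hw := Finset.ne_of_mem_erase hw
      simp [hw]
  · intro y _ hy
    obtain ⟨w, hwv, hw⟩ : ∃ w, w ≠ v ∧ x w ≠ y w := by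
      by_contra! h
      refine hy (Finset.mem_image.2 ⟨y v, Finset.mem_univ _, ?_⟩)
      ext w
      by_cases hwv : w = v
      · subst hwv; simp
      · simp [hwv, h w hwv]
    rw [Finset.prod_eq_zero (Finset.mem_univ w), zero_mul]
    simp [hwv, hw]

theorem applyLocal_one (ψ : QState V) : applyLocal 1 ψ = ψ := by
  ext x
  unfold applyLocal
  rw [Finset.sum_eq_single x]
  · simp
  · intro y _ hy
    obtain ⟨w, hw⟩ := Function.ne_iff.1 hy
    rw [Finset.prod_eq_zero (Finset.mem_univ w), zero_mul]
    simp [hw.symm]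
  · simp

theorem IsClifford.star_mul_self {U : Matrix (Fin 2) (Fin 2) ℂ} (hU : IsClifford U) :
    star U * U = 1 :=
  Matrix.mem_unitaryGroup_iff'.1 hU.1

theorem applyAt_applyAt_same (v : V) (M N : Matrix (Fin 2) (Fin 2) ℂ) (ψ : QState V) :
    applyAt v M (applyAt v N ψ) = applyLocal (Function.update 1 v (M * N)) ψ := by
  rw [applyAt_eq_applyLocal, applyAt_eq_applyLocal, applyLocal_applyLocal, ← Function.update_mul,
    one_mul]

/-- Adaptivity disappears along a single branch, where one-qubit operators simply compose. The state
stays nonzero because Cliffords are invertible and only outcomes with nonzero projection are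
followed. -/
theorem Protocol.exists_applyLocal_of_mem_finalStates (p : Protocol V) :
    ∀ {ψ φ : QState V}, ψ ≠ 0 → φ ∈ p.finalStates ψ →
      φ ≠ 0 ∧ ∃ A : V → Matrix (Fin 2) (Fin 2) ℂ, φ = applyLocal A ψ := by
  induction p with
  | done =>
    rintro ψ φ hψ rfl
    exact ⟨hψ, 1, (applyLocal_one _).symm⟩
  | clifford v U hU next ih =>
    intro ψ φ hψ hφ
    have h : applyAt v U ψ ≠ 0 := by
      intro h
      refine hψ ?_
      have h' := applyAt_applyAt_same v (star U) U ψ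
      rw [h, applyAt_zero, hU.star_mul_self, ← Pi.one_apply (M := fun _ => Matrix (Fin 2) (Fin 2) ℂ) v,
        Function.update_eq_self, applyLocal_one] at h'
      exact h'.symm
    obtain ⟨h0, A, rfl⟩ := ih h hφ
    exact ⟨h0, _, by rw [applyAt_eq_applyLocal, applyLocal_applyLocal]⟩
  | measure v P next ih =>
    rintro ψ φ hψ ⟨o, h, hφ⟩
    obtain ⟨h0, A, rfl⟩ := ih o h hφ
    exact ⟨h0, _, by rw [applyAt_eq_applyLocal, applyLocal_applyLocal]⟩

/-- If a product operator produces a Bell pair on the qubits `a`, `b`, then its factor at `a` is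
invertible. -/
theorem det_ne_zero_of_applyLocal_eq_bell {A : V → Matrix (Fin 2) (Fin 2) ℂ} {ψ : QState V}
    {a b : V} (hab : a ≠ b) {g : QState V}
    (hg : ∀ x i j, g (Function.update (Function.update x b j) a i) = g x)
    (h : ∀ x, applyLocal A ψ x = bell (x a) (x b) * g x) (h0 : applyLocal A ψ ≠ 0) :
    (A a).det ≠ 0 := by
  intro hdet
  -- Contracting qubit `a` with a left null vector `r` of `A a` annihilates the output state.
  obtain ⟨r, hr, hrA⟩ := Matrix.exists_vecMul_eq_zero_iff.2 hdet
  obtain ⟨i, hi⟩ := Function.ne_iff.1 hr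
  obtain ⟨x, hx⟩ := Function.ne_iff.1 h0
  have hgx : g x ≠ 0 := fun hgx => hx (by simp [h, hgx])
  have hz : applyAt a (Matrix.of fun _ => r) (applyLocal A ψ) = 0 := by
    rw [applyAt_eq_applyLocal, applyLocal_applyLocal]
    ext y
    refine Finset.sum_eq_zero fun z _ => ?_
    rw [Finset.prod_eq_zero (Finset.mem_univ a), zero_mul]
    simpa [Matrix.mul_apply, Matrix.vecMul, dotProduct] using congrFun hrA (z a)
  -- With qubit `b` set to `i`, the Bell factor keeps only the term `r i * bell i i * g x`, which is
  -- nonzero.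
  have hz := congrFun hz (Function.update x b i)
  rw [applyAt, Finset.sum_eq_single i] at hz
  · simp only [Matrix.of_apply, h, hg, Function.update_self, Function.update_of_ne hab.symm,
      Pi.zero_apply, mul_eq_zero, hgx, or_false] at hz
    rcases hz with hz | hz
    · exact hi hz
    · simp [bell] at hz
  · intro j _ hj
    simp [h, Function.update_of_ne hab.symm, bell, hj]
  · simp

end Operators

/-! ### The hexagon and the butterfly are locally equivalent -/

/-- The Hadamard gate. -/
noncomputable def hadamard : Matrix (Fin 2) (Fin 2) ℂ :=
  ((1 / Real.sqrt 2 : ℝ) : ℂ) • !![1, 1; 1, -1]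

theorem inv_sqrt_two_mul_self :
    ((1 / Real.sqrt 2 : ℝ) : ℂ) * ((1 / Real.sqrt 2 : ℝ) : ℂ) = 1 / 2 := by
  rw [← Complex.ofReal_mul, div_mul_div_comm, Real.mul_self_sqrt zero_le_two]
  simp

theorem star_hadamard : star hadamard = hadamard := by
  ext i j
  fin_cases i <;> fin_cases j <;> simp [hadamard, Matrix.star_apply]

theorem hadamard_mul_mul (M : Matrix (Fin 2) (Fin 2) ℂ) : hadamard * M * hadamard =
    (1 / 2 : ℂ) • (!![1, 1; 1, -1] * M * !![1, 1; 1, -1]) := by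
  rw [hadamard, Matrix.smul_mul, Matrix.smul_mul, Matrix.mul_smul, smul_smul,
    inv_sqrt_two_mul_self]

theorem hadamard_mul_self : hadamard * hadamard = 1 := by
  have h := hadamard_mul_mul 1
  rw [Matrix.mul_one, Matrix.mul_one] at h
  rw [h]
  ext i j
  fin_cases i <;> fin_cases j <;> norm_num [Matrix.mul_apply, Fin.sum_univ_two]

theorem isClifford_hadamard : IsClifford hadamard := by
  refine ⟨Matrix.mem_unitaryGroup_iff.2 (by rw [star_hadamard, hadamard_mul_self]), ?_⟩
  rw [star_hadamard]
  rintro (_ | _ | _)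
  · refine ⟨.Z, Or.inl ?_⟩
    rw [hadamard_mul_mul]
    ext i j
    fin_cases i <;> fin_cases j <;>
      norm_num [Pauli.mat, Matrix.mul_apply, Fin.sum_univ_two]
  · refine ⟨.Y, Or.inr ?_⟩
    rw [hadamard_mul_mul]
    ext i j
    fin_cases i <;> fin_cases j <;>
      norm_num [Pauli.mat, Matrix.mul_apply, Fin.sum_univ_two] <;> ring
  · refine ⟨.X, Or.inl ?_⟩
    rw [hadamard_mul_mul]
    ext i j
    fin_cases i <;> fin_cases j <;>
      norm_num [Pauli.mat, Matrix.mul_apply, Fin.sum_univ_two]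

theorem isClifford_one : IsClifford 1 := by
  refine ⟨one_mem _, fun P => ⟨P, Or.inl ?_⟩⟩
  simp

theorem applyAt_hadamard {V : Type*} [DecidableEq V] (v : V) (ψ : QState V) (x : V → Fin 2) :
    applyAt v hadamard ψ x = ((1 / Real.sqrt 2 : ℝ) : ℂ) *
      (ψ (Function.update x v 0) +
        (if x v = 1 then -1 else 1) * ψ (Function.update x v 1)) := by
  rw [applyAt, Fin.sum_univ_two]
  rcases Fin.exists_fin_two.1 ⟨x v, rfl⟩ with h | h <;> simp [hadamard, h] <;> ring

/-- Each amplitude is a sum of four signs over the values at `1` and `2`. The sum is `±2`, and the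
two Hadamards contribute the factor `1 / 2`. -/
theorem applyAt_hadamard_butterfly :
    applyAt 1 hadamard (applyAt 2 hadamard (graphState butterfly)) = graphState hexagon := by
  ext x
  have hp : ∀ y, plusState (Fin 6) y = plusState (Fin 6) x := fun _ => rfl
  simp only [applyAt_hadamard, graphState_butterfly, graphState_hexagon, czDiagonal_mk, hp]
  generalize plusState (Fin 6) x = p
  have hc := inv_sqrt_two_mul_self
  generalize ((1 / Real.sqrt 2 : ℝ) : ℂ) = c at hc
  simp only [Function.update_apply, Fin.reduceEq, if_true, if_false]
  have h01 : ∀ i : Fin 6, x i = 0 ∨ x i = 1 := fun i => Fin.exists_fin_two.1 ⟨x i, rfl⟩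
  rcases h01 1 with h1 | h1 <;> rcases h01 2 with h2 | h2 <;> rcases h01 3 with h3 | h3 <;>
    rcases h01 4 with h4 | h4 <;> simp [h1, h2, h3, h4] <;>
    rcases h01 5 with h5 | h5 <;> rcases h01 0 with h6 | h6 <;> simp [h5, h6] <;>
    first
      | linear_combination (2 * p) * hc
      | linear_combination (-2 * p) * hc

theorem locallyEquivalent_butterfly_hexagon :
    LocallyEquivalent (graphState butterfly) (graphState hexagon) := by
  refine ⟨Function.update (1 : Fin 6 → Matrix (Fin 2) (Fin 2) ℂ) 1 hadamard *
    Function.update (1 : Fin 6 → Matrix (Fin 2) (Fin 2) ℂ) 2 hadamard, fun v => ?_, ?_⟩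
  · by_cases h1 : v = 1
    · subst h1; simpa using isClifford_hadamard
    · by_cases h2 : v = 2
      · subst h2; simpa using isClifford_hadamard
      · simpa [h1, h2] using isClifford_one
  · rw [← applyLocal_applyLocal, ← applyAt_eq_applyLocal, ← applyAt_eq_applyLocal,
      applyAt_hadamard_butterfly]

/-! ### Bell pairs -/

/-- The state is a product of a state of `1, 3`, a state of `2, 5` and a state of `4, 6`. -/
def IsTripleProduct (ψ : QState (Fin 6)) : Prop :=
  ∃ α β ρ : Fin 2 → Fin 2 → ℂ, ∀ x, ψ x = α (x 1) (x 3) * β (x 2) (x 5) * ρ (x 4) (x 6)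

/-- Unlike the Bell form itself, this coarser property survives every one-qubit operator, so local
factors can be undone. -/
theorem IsTripleProduct.applyAt {ψ : QState (Fin 6)} (h : IsTripleProduct ψ) (v : Fin 6)
    (M : Matrix (Fin 2) (Fin 2) ℂ) : IsTripleProduct (applyAt v M ψ) := by
  obtain ⟨α, β, ρ, h⟩ := h
  fin_cases v
  · exact ⟨α, β, fun i j => ∑ b, M j b * ρ i b, fun x => by
      simp [_root_.applyAt, h, show (6 : Fin 6) = 0 from rfl]; ring⟩
  · exact ⟨fun i j => ∑ b, M i b * α b j, β, ρ, fun x => by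
      simp [_root_.applyAt, h]; ring⟩
  · exact ⟨α, fun i j => ∑ b, M i b * β b j, ρ, fun x => by
      simp [_root_.applyAt, h]; ring⟩
  · exact ⟨fun i j => ∑ b, M j b * α i b, β, ρ, fun x => by
      simp [_root_.applyAt, h]; ring⟩
  · exact ⟨α, β, fun i j => ∑ b, M i b * ρ b j, fun x => by
      simp [_root_.applyAt, h]; ring⟩
  · exact ⟨α, fun i j => ∑ b, M j b * β i b, ρ, fun x => by
      simp [_root_.applyAt, h]; ring⟩

/-- A product state for the partition `13 | 25 | 46` is not obtained from the hexagon by operators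
on the qubits `4` and `6`: the edge `2 - 3` stays entangled. -/
theorem not_isTripleProduct_of_hexagon (M N : Matrix (Fin 2) (Fin 2) ℂ)
    (h0 : applyAt 4 M (applyAt 6 N (graphState hexagon)) ≠ 0) :
    ¬ IsTripleProduct (applyAt 4 M (applyAt 6 N (graphState hexagon))) := by
  rintro ⟨α, β, ρ, h⟩
  obtain ⟨x, hx⟩ := Function.ne_iff.1 h0
  /- the state is `czDiagonal s(1, 2) * czDiagonal s(2, 3) * czDiagonal s(3, 5)` times `F` -/
  obtain ⟨F, hF⟩ : ∃ F : Fin 2 → Fin 2 → Fin 2 → Fin 2 → ℂ, ∀ y : Fin 6 → Fin 2,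
      applyAt 4 M (applyAt 6 N (graphState hexagon)) y =
        czDiagonal s(1, 2) y * czDiagonal s(2, 3) y * czDiagonal s(3, 5) y *
          F (y 1) (y 5) (y 4) (y 6) := by
    -- `F` collects the edges `56`, `64`, `41`, which meet the qubits acted on; `b` and `b'` are the
    -- summed values at `4` and `6`.
    refine ⟨fun a e i j => ∑ b, ∑ b', M i b * N j b' *
      ((if e = 1 ∧ b' = 1 then -1 else 1) * (if b' = 1 ∧ b = 1 then -1 else 1) *
        (if b = 1 ∧ a = 1 then -1 else 1) * plusState (Fin 6) 0), fun y => ?_⟩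
    have hp : ∀ y, plusState (Fin 6) y = plusState (Fin 6) 0 := fun _ => rfl
    simp only [applyAt, graphState_hexagon, czDiagonal_mk, hp, Function.update_apply,
      Fin.reduceEq, if_false, if_true, Finset.mul_sum]
    refine Finset.sum_congr rfl fun b _ => Finset.sum_congr rfl fun b' _ => ?_
    ring
  have hG : F (x 1) (x 5) (x 4) (x 6) ≠ 0 := by
    intro hG
    exact hx (by rw [hF, hG, mul_zero, Pi.zero_apply])
  have key : ∀ i j : Fin 2, α (x 1) i * β j (x 5) * ρ (x 4) (x 6) =
      (if x 1 = 1 ∧ j = 1 then -1 else 1) * (if j = 1 ∧ i = 1 then -1 else 1) *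
        (if i = 1 ∧ x 5 = 1 then -1 else 1) * F (x 1) (x 5) (x 4) (x 6) := by
    intro i j
    have h1 := h (Function.update (Function.update x 3 i) 2 j)
    rw [hF] at h1
    simp only [czDiagonal_mk, Function.update_apply, Fin.reduceEq, if_false, if_true] at h1
    exact h1.symm
  have k00 := key 0 0
  have k01 := key 0 1
  have k10 := key 1 0
  have k11 := key 1 1
  -- With the other qubits fixed, the product form gives a `2 × 2` array in the values at `3` and
  -- `2` of rank at most one. Up to row and column signs it is `F` times the sign matrix of the edge
  -- `23`, whose determinant is nonzero, so `F` would vanish.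
  have hdet : (α (x 1) 0 * β 0 (x 5) * ρ (x 4) (x 6)) * (α (x 1) 1 * β 1 (x 5) * ρ (x 4) (x 6)) =
      (α (x 1) 0 * β 1 (x 5) * ρ (x 4) (x 6)) * (α (x 1) 1 * β 0 (x 5) * ρ (x 4) (x 6)) := by
    ring
  rw [k00, k01, k10, k11] at hdet
  refine hG (mul_self_eq_zero.1 ?_)
  generalize F (x 1) (x 5) (x 4) (x 6) = f at hdet
  rcases Fin.exists_fin_two.1 ⟨x 1, rfl⟩ with h1 | h1 <;>
    rcases Fin.exists_fin_two.1 ⟨x 5, rfl⟩ with h5 | h5 <;>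
    simp only [h1, h5, and_true, if_true, zero_ne_one,
      if_false, and_false] at hdet <;>
    first
      | linear_combination (1 / 2) * hdet
      | linear_combination (-1 / 2) * hdet

theorem IsTwoBellPairs.isTripleProduct {φ : QState (Fin 6)} (h : IsTwoBellPairs 1 3 2 5 φ) :
    IsTripleProduct φ := by
  obtain ⟨rest, h⟩ := h
  refine ⟨bell, bell, fun i j => rest fun v => if v.1 = 4 then i else j, fun x => ?_⟩
  rw [h]
  congr 2
  funext ⟨v, hv⟩
  revert hv
  fin_cases v <;> simp

/-- Qubits `4` and `6` are acted on innermost, so if that part vanishes, the whole does. -/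
theorem applyLocal_eq_applyAt (A : Fin 6 → Matrix (Fin 2) (Fin 2) ℂ) (ψ : QState (Fin 6)) :
    applyLocal A ψ = applyAt 1 (A 1) (applyAt 2 (A 2) (applyAt 3 (A 3) (applyAt 5 (A 5)
      (applyAt 4 (A 4) (applyAt 6 (A 6) ψ))))) := by
  simp only [applyAt_eq_applyLocal, applyLocal_applyLocal]
  congr 1
  funext v
  fin_cases v <;> simp

theorem not_isTwoBellPairs_applyLocal_hexagon (A : Fin 6 → Matrix (Fin 2) (Fin 2) ℂ)
    (h0 : applyLocal A (graphState hexagon) ≠ 0) :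
    ¬ IsTwoBellPairs 1 3 2 5 (applyLocal A (graphState hexagon)) := by
  intro h
  have hprod := h.isTripleProduct
  have hdet : ∀ v : Fin 6, v ≠ 4 → v ≠ 6 → (A v).det ≠ 0 := by
    obtain ⟨rest, h⟩ := h
    have hbell : ∀ i j, bell i j = bell j i := fun i j => by simp [bell, eq_comm]
    have hrest : ∀ (x : Fin 6 → Fin 2) (a b : Fin 6) (i j : Fin 2),
        (a = 1 ∨ a = 3 ∨ a = 2 ∨ a = 5) → (b = 1 ∨ b = 3 ∨ b = 2 ∨ b = 5) →
        (rest fun v => Function.update (Function.update x b j) a i v) = rest fun v => x v := by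
      intro x a b i j ha hb
      congr 1
      funext ⟨v, hv1, hv3, hv2, hv5⟩
      have hva : v ≠ a := by rintro rfl; tauto
      have hvb : v ≠ b := by rintro rfl; tauto
      simp [hva, hvb]
    intro v hv4 hv6
    have hv : v = 1 ∨ v = 2 ∨ v = 3 ∨ v = 5 := by revert v; decide
    rcases hv with rfl | rfl | rfl | rfl
    · refine det_ne_zero_of_applyLocal_eq_bell (b := 3)
        (g := fun x => bell (x 2) (x 5) * rest fun v => x v) (by decide) (fun x i j => ?_)
        (fun x => by rw [h]; ring) h0
      simp only [hrest x 1 3 i j (by simp) (by simp)]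
      simp
    · refine det_ne_zero_of_applyLocal_eq_bell (b := 5)
        (g := fun x => bell (x 1) (x 3) * rest fun v => x v) (by decide) (fun x i j => ?_)
        (fun x => by rw [h]; ring) h0
      simp only [hrest x 2 5 i j (by simp) (by simp)]
      simp
    · refine det_ne_zero_of_applyLocal_eq_bell (b := 1)
        (g := fun x => bell (x 2) (x 5) * rest fun v => x v) (by decide) (fun x i j => ?_)
        (fun x => by rw [h, hbell]; ring) h0
      simp only [hrest x 3 1 i j (by simp) (by simp)]
      simp
    · refine det_ne_zero_of_applyLocal_eq_bell (b := 2)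
        (g := fun x => bell (x 1) (x 3) * rest fun v => x v) (by decide) (fun x i j => ?_)
        (fun x => by rw [h, hbell (x 2)]; ring) h0
      simp only [hrest x 5 2 i j (by simp) (by simp)]
      simp
  -- `B` undoes the four invertible factors and leaves `4` and `6` alone, where `A` may be a
  -- singular projection.
  let B : Fin 6 → Matrix (Fin 2) (Fin 2) ℂ := fun v => if v = 4 ∨ v = 6 then 1 else (A v)⁻¹
  have hB : applyLocal B (applyLocal A (graphState hexagon)) =
      applyAt 4 (A 4) (applyAt 6 (A 6) (graphState hexagon)) := by
    simp only [applyAt_eq_applyLocal, applyLocal_applyLocal]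
    congr 1
    funext v
    by_cases h4 : v = 4
    · subst h4; simp [B]
    by_cases h6 : v = 6
    · subst h6; simp [B]
    have h6' : v ≠ 0 := h6
    simp [B, h4, h6', Matrix.nonsing_inv_mul _ (hdet v h4 h6).isUnit]
  refine not_isTripleProduct_of_hexagon (A 4) (A 6) (fun hz => h0 ?_) (hB ▸ ?_)
  · rw [applyLocal_eq_applyAt, hz]
    simp only [applyAt_zero]
  · rw [applyLocal_eq_applyAt B]
    exact (((((hprod.applyAt _ _).applyAt _ _).applyAt _ _).applyAt _ _).applyAt _ _).applyAt _ _

/-- Allowing a product operator `B` in front treats both graph states at once: `B = 1` for the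
hexagon, the inverse local Clifford for the butterfly. -/
theorem not_bellPairsExtractable_of_applyLocal_hexagon {ψ : QState (Fin 6)}
    {B : Fin 6 → Matrix (Fin 2) (Fin 2) ℂ} (hψ : ψ = applyLocal B (graphState hexagon))
    (h0 : ψ ≠ 0) : ¬ BellPairsExtractable 1 3 2 5 ψ := by
  rintro ⟨p, φ, hφ, hbell⟩
  obtain ⟨hφ0, A, rfl⟩ := p.exists_applyLocal_of_mem_finalStates h0 hφ
  subst hψ
  rw [applyLocal_applyLocal] at hφ0 hbell
  exact not_isTwoBellPairs_applyLocal_hexagon _ hφ0 hbell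

theorem LocallyEquivalent.exists_applyLocal_eq {V : Type*} [Fintype V] [DecidableEq V]
    {ψ φ : QState V} (h : LocallyEquivalent ψ φ) :
    ∃ B : V → Matrix (Fin 2) (Fin 2) ℂ, ψ = applyLocal B φ := by
  obtain ⟨U, hU, rfl⟩ := h
  refine ⟨star U, ?_⟩
  rw [applyLocal_applyLocal, show star U * U = 1 from funext fun v => (hU v).star_mul_self,
    applyLocal_one]

theorem mainTheorem2 :
    localComplementPair 1 2 butterfly = hexagon ∧
    Nonempty (hexagon ≃g SimpleGraph.cycleGraph 6) ∧
    LocallyEquivalent (graphState butterfly) (graphState hexagon) ∧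
    ¬ BellPairsExtractable 1 3 2 5 (graphState hexagon) ∧
    ¬ BellPairsExtractable 1 3 2 5 (graphState butterfly) := by
  have hne : ∀ G : SimpleGraph (Fin 6), graphState G ≠ 0 := fun G h =>
    graphState_ne_zero G 0 (congrFun h 0)
  obtain ⟨B, hB⟩ := locallyEquivalent_butterfly_hexagon.exists_applyLocal_eq
  exact ⟨localComplementPair_butterfly, ⟨hexagonIsoCycleGraph⟩,
    locallyEquivalent_butterfly_hexagon,
    not_bellPairsExtractable_of_applyLocal_hexagon (applyLocal_one _).symm (hne _),
    not_bellPairsExtractable_of_applyLocal_hexagon hB (hne _)⟩
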